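/- An \emph{ultraposet} is a partially ordered set $P$ together with, for every set $S$, every family $f : S \to P$ and every ultrafilter $\mu$ on $S$, an element $\langle f,\mu\rangle \in P$, such that (writing $\langle f,\mu\rangle$ for the family $t \mapsto \langle f,\mu_t\rangle$ when $\mu=(\mu_t)_{t\in T}$ is a family of ultrafilters on $S$, and $\langle \mu,\nu\rangle = \{A \subseteq S : \{t : A\in\mu_t\}\in\nu\}$ for an ultrafilter $\nu$ on $T$): (i) $f \le g$ pointwise implies $\langle f,\mu\rangle \le \langle g,\mu\rangle$; (ii) $\langle f,\delta_s\rangle = f(s)$ for the principal ultrafilter $\delta_s$ at $s \in S$; (iii) $\langle f,\langle\mu,\nu\rangle\rangle \le \langle\langle f,\mu\rangle,\nu\rangle$; (iv) $\langle f, i_*\nu\rangle = \langle f\circ i,\nu\rangle$ for every injection $i : W \to S$ and every ultrafilter $\nu$ on $W$. A \emph{left ultrafunctor} $\varphi : P \to Q$ is a monotone map with $\varphi\langle f,\mu\rangle \le \langle\varphi f,\mu\rangle$ for all $f,\mu$; it is an \emph{ultrafunctor} if equality always holds. Let $\mathbf{UltPos}$ and $\mathbf{UltLPos}$ be the categories of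 ultraposets with ultrafunctors and with left ultrafunctors, respectively. A subset $K \subseteq P$ is \emph{closed} if $f^{-1}(K)\in\mu$ implies $\langle f,\mu\rangle\in K$ for all $f : S \to P$ and all $\mu$. The ultraposet $P$ is \emph{zero-dimensional} if for all $p,q\in P$ with $p\not\le q$ there is a closed downward closed subset $K \subseteq P$, whose complement $\overline K = P\setminus K$ is closed and upward closed, such that $p\in\overline K$ and $q\in K$. For a bounded distributive lattice $D$, let $\mathrm{Mod}(D)$ be the set of bounded lattice homomorphisms $D \to \mathbf 2 = \{0<1\}$, ordered pointwise, with $\langle f,\mu\rangle(d)=1$ iff $\{s : f(s)(d)=1\}\in\mu$; with precomposition on morphisms this is a functor $\mathrm{Mod} : \mathbf{DL}^{\mathrm{op}} \to \mathbf{UltPos}$, where $\mathbf{DL}$ is the category of bounded distributive lattices. Let $\mathbf{CLoc}$ be the full subcategory of the category of locales on the coherent locales, i.e. those whose compact elements are closed under finite meets (including the top element) and such that every element is a join of compact elements. For a coherent locale $L$, let $\mathrm{pt}(L)$ be the set of frame homomorphisms $L\to\mathbf 2$, ordered pointwise, with $\langle f,\mu\rangle(a)=1$ iff there is a compact $k\le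 a$ with $\{s : f(s)(k)=1\}\in\mu$ (this is the structure for which restriction to the lattice $D$ of compact elements of $L$ is an isomorphism of ultraposets $\mathrm{pt}(L)\cong\mathrm{Mod}(D)$); with precomposition by inverse image maps on morphisms this is a functor $\mathrm{pt} : \mathbf{CLoc}\to\mathbf{UltLPos}$. Let $\mathbf{CUltPos}$ be the full subcategory of $\mathbf{UltPos}$ on the essential image of $\mathrm{Mod}$, and let $\mathbf{CUltLPos}$ be the full subcategory of $\mathbf{UltLPos}$ on the essential image of $\mathrm{pt}$. \textbf{Theorem.} $\mathbf{CUltPos}$ (resp. $\mathbf{CUltLPos}$) is exactly the category of zero-dimensional ultraposets with ultrafunctors (resp. left ultrafunctors) between them: an ultraposet is isomorphic in $\mathbf{UltPos}$ to $\mathrm{Mod}(D)$ for some bounded distributive lattice $D$ if and only if it is zero-dimensional, and it is isomorphic in $\mathbf{UltLPos}$ to $\mathrm{pt}(L)$ for some coherent locale $L$ if and only if it is zero-dimensional. -/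

import Mathlib

universe u

open CategoryTheory

/-- An ultraposet: a poset `P` in which every family `f : S → P` has an ultraproduct
`pair f μ` along every ultrafilter `μ` on `S`. The pairing of `f` with a family
`μ : T → Ultrafilter S` is the family `fun t => pair f (μ t)`; the pairing of
`μ : T → Ultrafilter S` with an ultrafilter `ν` on `T` is `ν.bind μ`, which contains `A`
iff `{t | A ∈ μ t} ∈ ν`; the principal ultrafilter at `s` is `pure s`. -/
class Ultraposet (P : Type u) extends PartialOrder P where
  /-- The ultraproduct of a family along an ultrafilter. -/
  pair : {S : Type u} → (S → P) → Ultrafilter S → P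
  pair_mono : ∀ {S : Type u} (μ : Ultrafilter S) (f g : S → P),
    (∀ s, f s ≤ g s) → pair f μ ≤ pair g μ
  /-- Unity. -/
  pair_pure : ∀ {S : Type u} (f : S → P) (s : S), pair f (pure s : Ultrafilter S) = f s
  /-- Lax associativity. -/
  pair_bind_le : ∀ {S T : Type u} (f : S → P) (μ : T → Ultrafilter S) (ν : Ultrafilter T),
    pair f (ν.bind μ) ≤ pair (fun t => pair f (μ t)) ν
  /-- Locality. -/
  pair_map : ∀ {S W : Type u} (f : S → P) (i : W → S) (ν : Ultrafilter W),
    Function.Injective i → pair f (ν.map i) = pair (fun w => f (i w)) ν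

namespace Ultraposet

/-- A subset `K` is closed if it contains every ultraproduct of a family that lies in `K`
almost everywhere. -/
def IsClosedSubset {P : Type u} [Ultraposet P] (K : Set P) : Prop :=
  ∀ (S : Type u) (f : S → P) (μ : Ultrafilter S), f ⁻¹' K ∈ μ → pair f μ ∈ K

/-- `(K, L)` is a complemented pair consisting of a closed downset `K` and a closed upset `L`. -/
structure IsClosedPair {P : Type u} [Ultraposet P] (K L : Set P) : Prop where
  compl : L = Kᶜ
  isClosed_left : IsClosedSubset K
  isLowerSet_left : IsLowerSet K
  isClosed_right : IsClosedSubset L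
  isUpperSet_right : IsUpperSet L

/-- An ultraposet is zero-dimensional if, whenever `p ≰ q`, there is a complemented pair
`(K, L)`, with `K` a closed downset and `L` a closed upset, such that `p ∈ L` and `q ∈ K`. -/
def IsZeroDimensional (P : Type u) [Ultraposet P] : Prop :=
  ∀ p q : P, ¬ p ≤ q → ∃ K L : Set P, IsClosedPair K L ∧ p ∈ L ∧ q ∈ K

end Ultraposet

/-- A left ultrafunctor: a monotone map `φ` with `φ ⟨f, μ⟩ ≤ ⟨φ f, μ⟩`. -/
@[ext]
structure LeftUltrafunctor (P Q : Type u) [Ultraposet P] [Ultraposet Q] where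
  toFun : P → Q
  monotone : Monotone toFun
  map_pair_le : ∀ {S : Type u} (f : S → P) (μ : Ultrafilter S),
    toFun (Ultraposet.pair f μ) ≤ Ultraposet.pair (fun s => toFun (f s)) μ

/-- An ultrafunctor: a monotone map `φ` with `φ ⟨f, μ⟩ = ⟨φ f, μ⟩`. -/
@[ext]
structure Ultrafunctor (P Q : Type u) [Ultraposet P] [Ultraposet Q] where
  toFun : P → Q
  monotone : Monotone toFun
  map_pair : ∀ {S : Type u} (f : S → P) (μ : Ultrafilter S),
    toFun (Ultraposet.pair f μ) = Ultraposet.pair (fun s => toFun (f s)) μ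

/-- The objects of the category of ultraposets and ultrafunctors. -/
structure UltPos : Type (u + 1) where
  carrier : Type u
  [str : Ultraposet carrier]

attribute [instance] UltPos.str

instance : Category.{u} UltPos.{u} where
  Hom P Q := Ultrafunctor P.carrier Q.carrier
  id _ := ⟨fun x => x, fun _ _ h => h, fun _ _ => rfl⟩
  comp φ ψ := ⟨fun x => ψ.toFun (φ.toFun x), fun _ _ h => ψ.monotone (φ.monotone h),
    fun f μ => by rw [φ.map_pair, ψ.map_pair]⟩

/-- The objects of the category of ultraposets and left ultrafunctors. -/
structure UltLPos : Type (u + 1) where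
  carrier : Type u
  [str : Ultraposet carrier]

attribute [instance] UltLPos.str

instance : Category.{u} UltLPos.{u} where
  Hom P Q := LeftUltrafunctor P.carrier Q.carrier
  id _ := ⟨fun x => x, fun _ _ h => h, fun _ _ => le_rfl⟩
  comp φ ψ := ⟨fun x => ψ.toFun (φ.toFun x), fun _ _ h => ψ.monotone (φ.monotone h),
    fun f μ => (ψ.monotone (φ.map_pair_le f μ)).trans (ψ.map_pair_le _ μ)⟩

/-- A model of a bounded distributive lattice `D`: a bounded lattice homomorphism from `D`
to the two-element lattice. -/
abbrev LatticeModel (D : Type u) [DistribLattice D] [BoundedOrder D] : Type u :=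
  BoundedLatticeHom D Prop

namespace LatticeModel

variable {D : Type u} [DistribLattice D] [BoundedOrder D]

/-- The ultraproduct of models, computed pointwise: `p` holds in it iff `p` holds in almost
all factors. -/
def ultraproduct {S : Type u} (f : S → LatticeModel D) (μ : Ultrafilter S) : LatticeModel D where
  toFun p := {s | f s p} ∈ μ
  map_sup' a b := by
    simp only [map_sup]
    exact propext (Ultrafilter.union_mem_iff (f := μ) (s := {s | f s a}) (t := {s | f s b}))
  map_inf' a b := by
    simp only [map_inf]
    exact propext (Filter.inter_mem_iff (f := (μ : Filter S)) (s := {s | f s a})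
      (t := {s | f s b}))
  map_top' := by
    simp only [map_top]
    exact eq_true (Filter.univ_mem (f := (μ : Filter S)))
  map_bot' := by
    simp only [map_bot]
    exact eq_false (Ultrafilter.empty_notMem (f := μ))

/-- Models are ordered pointwise. -/
noncomputable instance : Ultraposet (LatticeModel D) where
  toPartialOrder := PartialOrder.lift (fun x : LatticeModel D => (x : D → Prop))
    DFunLike.coe_injective
  pair f μ := ultraproduct f μ
  pair_mono _ _ _ h p := fun hp => Filter.mem_of_superset hp fun s hs => h s p hs
  pair_pure _ _ := rfl
  pair_bind_le _ _ _ _ := id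
  pair_map _ _ _ _ := rfl

end LatticeModel

/-- The functor that sends a bounded distributive lattice to the ultraposet of its models, and
a homomorphism to precomposition with it. -/
noncomputable def modFunctor : BddDistLat.{u}ᵒᵖ ⥤ UltPos.{u} where
  obj D := { carrier := LatticeModel D.unop }
  map σ :=
    { toFun := fun x => BoundedLatticeHom.comp x σ.unop.hom
      monotone := fun _ _ h p => h (σ.unop.hom p)
      map_pair := fun _ _ => rfl }
  map_id _ := rfl
  map_comp _ _ := rfl

/-- A frame is coherent if its compact elements are closed under finite meets and every element
is a join of compact elements. -/
class IsCoherentFrame (L : Type u) [Order.Frame L] : Prop where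
  isCompactElement_top : IsCompactElement (⊤ : L)
  isCompactElement_inf : ∀ a b : L,
    IsCompactElement a → IsCompactElement b → IsCompactElement (a ⊓ b)
  eq_sSup_compact : ∀ a : L, a = sSup {k | IsCompactElement k ∧ k ≤ a}

/-- The category of coherent locales, a full subcategory of the category of locales. -/
abbrev CohLocale : Type (u + 1) :=
  ObjectProperty.FullSubcategory (C := Locale.{u}) fun L => IsCoherentFrame L

/-- A point of a frame `L`: a frame homomorphism from `L` to the two-element frame. Points are
ordered pointwise. -/
abbrev FramePoint (L : Type u) [Order.Frame L] : Type u := FrameHom L Prop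

namespace FramePoint

variable {L : Type u} [Order.Frame L]

theorem exists_compact_le_of_le_sSup [IsCoherentFrame L] {k : L} (hk : IsCompactElement k)
    {A : Set L} (h : k ≤ sSup A) :
    ∃ F : Finset L, k ≤ F.sup id ∧ ∀ l ∈ F, IsCompactElement l ∧ ∃ a ∈ A, l ≤ a := by
  have h' : k ≤ sSup {l : L | IsCompactElement l ∧ ∃ a ∈ A, l ≤ a} := by
    refine h.trans (sSup_le fun a ha => ?_)
    rw [IsCoherentFrame.eq_sSup_compact a]
    exact sSup_le_sSup fun l hl => ⟨hl.1, a, ha, hl.2⟩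
  obtain ⟨F, hF, hkF⟩ :=
    (CompleteLattice.isCompactElement_iff_exists_le_sSup_of_le_sSup L k).1 hk _ h'
  exact ⟨F, hkF, fun l hl => hF hl⟩

theorem apply_finset_sup (x : FramePoint L) (F : Finset L) (h : x (F.sup id)) :
    ∃ l ∈ F, x l := by
  classical
  induction F using Finset.induction_on with
  | empty =>
    rw [Finset.sup_empty, map_bot] at h
    exact h.elim
  | insert a F _ ih =>
    rw [Finset.sup_insert, map_sup] at h
    rcases h with h | h
    · exact ⟨a, Finset.mem_insert_self _ _, h⟩
    · obtain ⟨l, hl, hx⟩ := ih h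
      exact ⟨l, Finset.mem_insert_of_mem hl, hx⟩

theorem apply_mono (x : FramePoint L) {a b : L} (h : a ≤ b) (ha : x a) : x b :=
  (OrderHomClass.mono x h : x a ≤ x b) ha

/-- The ultraproduct of points of a coherent frame. On compact elements it is computed
pointwise, as for models of the lattice of compact elements; its value at any other element is
the join of its values at the compact elements below. -/
def ultraproduct [IsCoherentFrame L] {S : Type u} (f : S → FramePoint L) (μ : Ultrafilter S) :
    FramePoint L where
  toFun a := ∃ k, IsCompactElement k ∧ k ≤ a ∧ {s | f s k} ∈ μ
  map_inf' a b := by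
    refine propext ⟨?_, ?_⟩
    · rintro ⟨k, hk, hle, hm⟩
      exact ⟨⟨k, hk, hle.trans inf_le_left, hm⟩, ⟨k, hk, hle.trans inf_le_right, hm⟩⟩
    · rintro ⟨⟨k, hk, hka, hkm⟩, ⟨l, hl, hlb, hlm⟩⟩
      refine ⟨k ⊓ l, IsCoherentFrame.isCompactElement_inf k l hk hl, inf_le_inf hka hlb, ?_⟩
      refine Filter.mem_of_superset (Filter.inter_mem hkm hlm) fun s hs => ?_
      change f s (k ⊓ l)
      rw [map_inf]
      exact hs
  map_top' := by
    refine eq_true ⟨⊤, IsCoherentFrame.isCompactElement_top, le_rfl, ?_⟩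
    simp only [map_top]
    exact Filter.univ_mem (f := (μ : Filter S))
  map_sSup' A := by
    refine propext ⟨?_, ?_⟩
    · rintro ⟨k, hk, hle, hm⟩
      obtain ⟨F, hkF, hF⟩ := exists_compact_le_of_le_sSup hk hle
      have hU : (⋃ l ∈ (F : Set L), {s | f s l}) ∈ μ := by
        refine Filter.mem_of_superset hm fun s hs => ?_
        obtain ⟨l, hl, hx⟩ := apply_finset_sup (f s) F (apply_mono (f s) hkF hs)
        exact Set.mem_biUnion hl hx
      obtain ⟨l, hl, hlm⟩ := (Ultrafilter.finite_biUnion_mem_iff F.finite_toSet).1 hU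
      obtain ⟨hlc, a, ha, hla⟩ := hF l hl
      rw [sSup_Prop_eq]
      exact ⟨_, ⟨a, ha, rfl⟩, l, hlc, hla, hlm⟩
    · rw [sSup_Prop_eq]
      rintro ⟨_, ⟨a, ha, rfl⟩, k, hk, hle, hm⟩
      exact ⟨k, hk, hle.trans (le_sSup ha), hm⟩

theorem ultraproduct_apply_of_isCompactElement [IsCoherentFrame L] {S : Type u}
    (f : S → FramePoint L) (μ : Ultrafilter S) {k : L} (hk : IsCompactElement k) :
    ultraproduct f μ k ↔ {s | f s k} ∈ μ :=
  ⟨fun ⟨_, _, hle, hm⟩ => Filter.mem_of_superset hm fun s hs => apply_mono (f s) hle hs,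
    fun h => ⟨k, hk, le_rfl, h⟩⟩

noncomputable instance [IsCoherentFrame L] : Ultraposet (FramePoint L) where
  toPartialOrder := inferInstance
  pair f μ := ultraproduct f μ
  pair_mono _ _ _ h _ := fun ⟨k, hk, hle, hm⟩ =>
    ⟨k, hk, hle, Filter.mem_of_superset hm fun s hs => h s k hs⟩
  pair_pure f s := by
    refine DFunLike.ext _ _ fun a => propext ⟨?_, ?_⟩
    · rintro ⟨_, _, hle, hm⟩
      exact apply_mono (f s) hle hm
    · intro h
      rw [IsCoherentFrame.eq_sSup_compact a, map_sSup, sSup_Prop_eq] at h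
      obtain ⟨_, ⟨k, hk, rfl⟩, hx⟩ := h
      exact ⟨k, hk.1, hk.2, hx⟩
  pair_bind_le _ _ _ _ := fun ⟨k, hk, hle, hm⟩ =>
    ⟨k, hk, hle, Filter.mem_of_superset hm fun _ ht => ⟨k, hk, le_rfl, ht⟩⟩
  pair_map _ _ _ _ := rfl

end FramePoint

/-- The functor that sends a coherent locale to the ultraposet of its points, and a morphism of
locales to precomposition with its inverse image. -/
noncomputable def ptFunctor : CohLocale.{u} ⥤ UltLPos.{u} where
  obj L :=
    haveI : IsCoherentFrame L.obj := L.property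
    { carrier := FramePoint L.obj }
  map {L M} g :=
    haveI : IsCoherentFrame L.obj := L.property
    haveI : IsCoherentFrame M.obj := M.property
    { toFun := fun x => FrameHom.comp x g.hom.unop.hom
      monotone := fun _ _ h a => h (g.hom.unop.hom a)
      map_pair_le := by
        rintro S f μ a ⟨k, hk, hle, hm⟩
        have hle' : k ≤ sSup (g.hom.unop.hom '' {l | IsCompactElement l ∧ l ≤ a}) := by
          rw [← map_sSup, ← IsCoherentFrame.eq_sSup_compact a]
          exact hle
        obtain ⟨F, hkF, hF⟩ := FramePoint.exists_compact_le_of_le_sSup hk hle'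
        have hU : (⋃ l ∈ (F : Set L.obj), {s | f s l}) ∈ μ := by
          refine Filter.mem_of_superset hm fun s hs => ?_
          obtain ⟨l, hl, hx⟩ :=
            FramePoint.apply_finset_sup (f s) F (FramePoint.apply_mono (f s) hkF hs)
          exact Set.mem_biUnion hl hx
        obtain ⟨l, hl, hlm⟩ := (Ultrafilter.finite_biUnion_mem_iff F.finite_toSet).1 hU
        obtain ⟨_, _, ⟨m, hmc, rfl⟩, hlm'⟩ := hF l hl
        exact ⟨m, hmc.1, hmc.2,
          Filter.mem_of_superset hlm fun s hs => FramePoint.apply_mono (f s) hlm' hs⟩ }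
  map_id _ := rfl
  map_comp _ _ := rfl

/-- The objects of the full subcategory of ultraposets and ultrafunctors on the essential image
of the functor of models. -/
def CUltPos : ObjectProperty UltPos.{u} := modFunctor.{u}.essImage

/-- The objects of the full subcategory of ultraposets and left ultrafunctors on the essential
image of the functor of points of coherent locales. -/
def CUltLPos : ObjectProperty UltLPos.{u} := ptFunctor.{u}.essImage

/-! Call an upset clopen if it and its complement are closed; since an ultrafilter contains a set or
its complement, this means that an ultraproduct lies in the upset iff almost all factors do
(`isClopenUpset_iff`). Clopen upsets form a bounded distributive lattice, and zero-dimensionality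
says that they determine the order (`IsZeroDimensional.le_iff`). Hence sending a point to the prime
filter of clopen upsets containing it is an order embedding that preserves ultraproducts.

The crux is that every prime filter arises this way (`exists_forall_mem_iff`), which holds in any
ultraposet: the required memberships and non-memberships generate a proper filter on `P`, and the
ultraproduct of the identity along an ultrafilter refining it is the point sought. For locales, the
clopen upsets generate a topology in which they are exactly the compact opens, so the opens form a
coherent frame whose points are again these prime filters.

Conversely, `{x | x d}` is a clopen upset of models for every `d`, and `{x | x k}` is one of points
for compact `k`; these separate. Zero-dimensionality passes along isomorphisms, because an
invertible left ultrafunctor preserves ultraproducts exactly. -/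

namespace Ultraposet

/-! ### Clopen upsets and their prime filters -/

section ClopenUpset

variable {P : Type u} [Ultraposet P]

/-- A closed upset whose complement is closed. -/
def IsClopenUpset (L : Set P) : Prop :=
  IsClosedPair Lᶜ L

theorem IsClosedPair.isClopenUpset {K L : Set P} (h : IsClosedPair K L) : IsClopenUpset L := by
  obtain rfl : K = Lᶜ := by rw [h.compl, compl_compl]
  exact h

/-- An upset is clopen iff membership of ultraproducts in it is decided almost everywhere. -/
theorem isClopenUpset_iff {L : Set P} :
    IsClopenUpset L ↔ IsUpperSet L ∧
      ∀ (S : Type u) (f : S → P) (μ : Ultrafilter S), pair f μ ∈ L ↔ f ⁻¹' L ∈ μ := by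
  refine ⟨fun h => ⟨h.isUpperSet_right, fun S f μ => ⟨fun hp => ?_, h.isClosed_right S f μ⟩⟩,
    fun h => ⟨(compl_compl L).symm, fun S f μ hf hp => ?_, h.1.compl,
      fun S f μ => (h.2 S f μ).2, h.1⟩⟩
  · by_contra hf
    exact h.isClosed_left S f μ (Ultrafilter.compl_mem_iff_notMem.2 hf) hp
  · exact Ultrafilter.compl_mem_iff_notMem.1 hf ((h.2 S f μ).1 hp)

theorem IsClopenUpset.pair_mem_iff {L : Set P} (h : IsClopenUpset L) {S : Type u} (f : S → P)
    (μ : Ultrafilter S) : pair f μ ∈ L ↔ f ⁻¹' L ∈ μ :=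
  (isClopenUpset_iff.1 h).2 S f μ

theorem isClopenUpset_univ : IsClopenUpset (Set.univ : Set P) :=
  isClopenUpset_iff.2 ⟨isUpperSet_univ, fun S _ μ =>
    iff_of_true trivial (show Set.univ ∈ μ from Filter.univ_mem (f := (μ : Filter S)))⟩

theorem isClopenUpset_empty : IsClopenUpset (∅ : Set P) :=
  isClopenUpset_iff.2 ⟨isUpperSet_empty, fun _ _ _ => by simp⟩

theorem IsClopenUpset.union {L M : Set P} (hL : IsClopenUpset L) (hM : IsClopenUpset M) :
    IsClopenUpset (L ∪ M) :=
  isClopenUpset_iff.2 ⟨hL.isUpperSet_right.union hM.isUpperSet_right, fun _ _ _ => by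
    rw [Set.preimage_union, Ultrafilter.union_mem_iff, Set.mem_union, hL.pair_mem_iff,
      hM.pair_mem_iff]⟩

theorem IsClopenUpset.inter {L M : Set P} (hL : IsClopenUpset L) (hM : IsClopenUpset M) :
    IsClopenUpset (L ∩ M) :=
  isClopenUpset_iff.2 ⟨hL.isUpperSet_right.inter hM.isUpperSet_right, fun _ f μ => by
    rw [Set.preimage_inter, Set.mem_inter_iff, hL.pair_mem_iff, hM.pair_mem_iff]
    exact Filter.inter_mem_iff.symm⟩

theorem IsZeroDimensional.le_iff (hP : IsZeroDimensional P) {p q : P} :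
    p ≤ q ↔ ∀ L : Set P, IsClopenUpset L → p ∈ L → q ∈ L := by
  refine ⟨fun h L hL hp => hL.isUpperSet_right h hp, fun h => ?_⟩
  by_contra hpq
  obtain ⟨K, L, hKL, hp, hq⟩ := hP p q hpq
  have hqL := h L hKL.isClopenUpset hp
  rw [hKL.compl] at hqL
  exact hqL hq

/-- Ultraposets embedded in a zero-dimensional one are zero-dimensional. -/
theorem IsZeroDimensional.of_orderEmbedding {Q : Type u} [Ultraposet Q]
    (hQ : IsZeroDimensional Q) (φ : P ↪o Q)
    (hφ : ∀ (S : Type u) (f : S → P) (μ : Ultrafilter S),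
      φ (pair f μ) = pair (fun s => φ (f s)) μ) : IsZeroDimensional P := by
  intro p q hpq
  obtain ⟨K, L, h, hp, hq⟩ := hQ (φ p) (φ q) (by rwa [φ.le_iff_le])
  refine ⟨φ ⁻¹' K, φ ⁻¹' L, ⟨?_, fun S f μ hf => ?_, h.isLowerSet_left.preimage φ.monotone,
    fun S f μ hf => ?_, h.isUpperSet_right.preimage φ.monotone⟩, hp, hq⟩
  · rw [h.compl, Set.preimage_compl]
  · rw [Set.mem_preimage, hφ]
    exact h.isClosed_left S _ μ hf
  · rw [Set.mem_preimage, hφ]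
    exact h.isClosed_right S _ μ hf

/-- A family of clopen upsets that is a prime filter is the family of clopen upsets containing
some point. -/
theorem exists_forall_mem_iff (x : Set P → Prop) (h_univ : x Set.univ) (h_empty : ¬ x ∅)
    (h_inter : ∀ L M, IsClopenUpset L → IsClopenUpset M → x L → x M → x (L ∩ M))
    (h_union : ∀ L M, IsClopenUpset L → IsClopenUpset M → x (L ∪ M) → x L ∨ x M)
    (h_mono : ∀ L M, IsClopenUpset L → IsClopenUpset M → L ⊆ M → x L → x M) :
    ∃ p : P, ∀ L, IsClopenUpset L → (p ∈ L ↔ x L) := by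
  -- `L \ M` collects the points satisfying one required membership and one required non-membership.
  let B : FilterBasis P :=
    { sets := {A | ∃ L M, IsClopenUpset L ∧ IsClopenUpset M ∧ x L ∧ ¬ x M ∧ A = L \ M}
      nonempty := ⟨_, Set.univ, ∅, isClopenUpset_univ, isClopenUpset_empty, h_univ, h_empty, rfl⟩
      inter_sets := by
        rintro _ _ ⟨L, M, hL, hM, hxL, hxM, rfl⟩ ⟨L', M', hL', hM', hxL', hxM', rfl⟩
        refine ⟨_, ⟨L ∩ L', M ∪ M', hL.inter hL', hM.union hM', h_inter _ _ hL hL' hxL hxL',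
          fun h => (h_union _ _ hM hM' h).elim hxM hxM', rfl⟩, ?_⟩
        rintro p ⟨⟨h1, h2⟩, h3⟩
        exact ⟨⟨h1, fun h => h3 (Or.inl h)⟩, ⟨h2, fun h => h3 (Or.inr h)⟩⟩ }
  have hB : B.filter.NeBot := by
    rw [B.hasBasis.neBot_iff]
    rintro _ ⟨L, M, hL, hM, hxL, hxM, rfl⟩
    by_contra hne
    -- An empty `L \ M` means `L ⊆ M`, and then `x L` would force `x M`.
    exact hxM (h_mono L M hL hM (Set.sdiff_eq_empty.1 (Set.not_nonempty_iff_eq_empty.1 hne)) hxL)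
  refine ⟨pair id (Ultrafilter.of B.filter), fun L hL => ?_⟩
  rw [hL.pair_mem_iff, Set.preimage_id]
  refine ⟨fun h => ?_, fun h => ?_⟩
  · by_contra hx
    refine Ultrafilter.compl_mem_iff_notMem.1 (Ultrafilter.of_le _ (B.mem_filter_of_mem ?_)) h
    -- If `x L` fails, the complement of `L` is itself a basic set.
    exact ⟨Set.univ, L, isClopenUpset_univ, hL, h_univ, hx, Set.compl_eq_univ_sdiff L⟩
  · refine Ultrafilter.of_le _ (B.mem_filter_of_mem ?_)
    exact ⟨L, ∅, hL, isClopenUpset_empty, h, h_empty, Set.sdiff_empty.symm⟩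

end ClopenUpset

/-! ### Representation by models of the lattice of clopen upsets -/

section Lattice

variable (P : Type u) [Ultraposet P]

/-- The lattice of clopen upsets. -/
def clopenUpsets : Sublattice (Set P) where
  carrier := {L | IsClopenUpset L}
  supClosed' _ hL _ hM := IsClopenUpset.union hL hM
  infClosed' _ hL _ hM := IsClopenUpset.inter hL hM

instance : BoundedOrder (clopenUpsets P) :=
  Subtype.boundedOrder (p := fun L : Set P => L ∈ clopenUpsets P) isClopenUpset_empty
    isClopenUpset_univ

variable {P}

/-- The model of the lattice of clopen upsets given by a point. -/
def evalModel (p : P) : LatticeModel (clopenUpsets P) where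
  toFun L := p ∈ L.1
  map_sup' _ _ := rfl
  map_inf' _ _ := rfl
  map_top' := eq_true (Set.mem_univ p)
  map_bot' := eq_false (Set.notMem_empty p)

theorem evalModel_surjective : Function.Surjective (evalModel (P := P)) := by
  intro x
  obtain ⟨p, hp⟩ := exists_forall_mem_iff (P := P) (fun L => ∃ h : L ∈ clopenUpsets P, x ⟨L, h⟩)
    ⟨isClopenUpset_univ, of_eq_true (map_top x)⟩ (fun ⟨_, h⟩ => (map_bot x).le h)
    (fun L M _ _ ⟨hL, hxL⟩ ⟨hM, hxM⟩ => ⟨IsClopenUpset.inter hL hM,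
      (iff_of_eq (map_inf x (⟨L, hL⟩ : clopenUpsets P) ⟨M, hM⟩)).2 ⟨hxL, hxM⟩⟩)
    (fun L M hL hM ⟨_, h⟩ =>
      ((iff_of_eq (map_sup x (⟨L, hL⟩ : clopenUpsets P) ⟨M, hM⟩)).1 h).imp
        (fun h => ⟨hL, h⟩) (fun h => ⟨hM, h⟩))
    (fun L M _ hM hLM ⟨hL, h⟩ =>
      ⟨hM, (OrderHomClass.mono x (show (⟨L, hL⟩ : clopenUpsets P) ≤ ⟨M, hM⟩ from hLM)) h⟩)
  exact ⟨p, DFunLike.ext _ _ fun L =>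
    propext ((hp L.1 L.2).trans ⟨fun ⟨_, h⟩ => h, fun h => ⟨L.2, h⟩⟩)⟩

/-- A zero-dimensional ultraposet is order isomorphic to the models of its clopen upsets. -/
noncomputable def IsZeroDimensional.modelOrderIso (hP : IsZeroDimensional P) :
    P ≃o LatticeModel (clopenUpsets P) :=
  RelIso.ofSurjective
    (OrderEmbedding.ofMapLEIff evalModel fun _ _ =>
      ⟨fun h => hP.le_iff.2 fun L hL => h ⟨L, hL⟩, fun h L => hP.le_iff.1 h L.1 L.2⟩)
    evalModel_surjective

theorem IsZeroDimensional.modelOrderIso_pair (hP : IsZeroDimensional P) (S : Type u) (f : S → P)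
    (μ : Ultrafilter S) :
    hP.modelOrderIso (pair f μ) = pair (fun s => hP.modelOrderIso (f s)) μ :=
  DFunLike.ext _ _ fun L => propext (IsClopenUpset.pair_mem_iff L.2 f μ)

end Lattice

/-! ### Representation by points of the frame of opens -/

section Opens

open TopologicalSpace

variable (P : Type u) [Ultraposet P]

/-- The topology on an ultraposet generated by its clopen upsets. -/
abbrev clopenUpsetTopology : TopologicalSpace P :=
  generateFrom {L : Set P | IsClopenUpset L}

attribute [local instance] clopenUpsetTopology

theorem isTopologicalBasis_isClopenUpset :
    IsTopologicalBasis {L : Set P | IsClopenUpset L} where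
  exists_subset_inter L hL M hM _ hp := ⟨L ∩ M, IsClopenUpset.inter hL hM, hp, subset_rfl⟩
  sUnion_eq := Set.eq_univ_of_univ_subset fun _ _ =>
    ⟨Set.univ, isClopenUpset_univ, Set.mem_univ _⟩
  eq_generateFrom := rfl

variable {P}

/-- An ultrafilter `μ` containing `L` converges to `pair id μ`: this point lies in `L`, and any
basic neighbourhood of it belongs to `μ` by clopenness. -/
theorem IsClopenUpset.isCompact {L : Set P} (hL : IsClopenUpset L) : IsCompact L := by
  rw [isCompact_iff_ultrafilter_le_nhds']
  intro μ hμ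
  refine ⟨pair id μ, (hL.pair_mem_iff id μ).2 hμ, ?_⟩
  rw [(isTopologicalBasis_isClopenUpset P).nhds_hasBasis.ge_iff]
  rintro M ⟨hM, hp⟩
  exact (IsClopenUpset.pair_mem_iff hM id μ).1 hp

/-- A clopen upset as an open set. -/
def IsClopenUpset.opens {L : Set P} (hL : IsClopenUpset L) : Opens P :=
  ⟨L, (isTopologicalBasis_isClopenUpset P).isOpen hL⟩

/-- A compact open is a finite union of basic opens, and clopen upsets are closed under finite
unions. -/
theorem isCompactElement_opens_iff {U : Opens P} :
    IsCompactElement U ↔ IsClopenUpset (U : Set P) := by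
  rw [Opens.isCompactElement_iff]
  refine ⟨fun h => ?_, fun h => h.isCompact⟩
  obtain ⟨s, hs, hU⟩ := eq_finite_iUnion_of_isTopologicalBasis_of_isCompact_open
    (Subtype.val : {L : Set P | IsClopenUpset L} → Set P)
    (by rw [Subtype.range_coe]; exact isTopologicalBasis_isClopenUpset P) U h U.2
  rw [hU]
  clear hU
  induction s, hs using Set.Finite.induction_on with
  | empty => simpa using isClopenUpset_empty
  | insert _ _ ih =>
    rw [Set.biUnion_insert]
    exact IsClopenUpset.union (Subtype.prop _) ih

theorem exists_isClopenUpset_of_mem {U : Opens P} {p : P} (hp : p ∈ U) :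
    ∃ (L : Set P) (hL : IsClopenUpset L), p ∈ L ∧ hL.opens ≤ U :=
  let ⟨L, hL, hpL, hLU⟩ := (isTopologicalBasis_isClopenUpset P).exists_subset_of_mem_open hp U.2
  ⟨L, hL, hpL, hLU⟩

theorem opens_eq_sSup (U : Opens P) : U = sSup {V | IsCompactElement V ∧ V ≤ U} := by
  refine le_antisymm (fun p hp => ?_) (sSup_le fun V hV => hV.2)
  obtain ⟨L, hL, hpL, hLU⟩ := exists_isClopenUpset_of_mem hp
  exact Opens.mem_sSup.2 ⟨hL.opens, ⟨isCompactElement_opens_iff.2 hL, hLU⟩, hpL⟩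

instance : IsCoherentFrame (Opens P) where
  isCompactElement_top := isCompactElement_opens_iff.2 isClopenUpset_univ
  isCompactElement_inf _ _ hU hV := isCompactElement_opens_iff.2
    ((isCompactElement_opens_iff.1 hU).inter (isCompactElement_opens_iff.1 hV))
  eq_sSup_compact := opens_eq_sSup

/-- The point of the frame of opens given by a point of the ultraposet. -/
def evalPoint (p : P) : FramePoint (Opens P) where
  toFun U := p ∈ U
  map_inf' _ _ := rfl
  map_top' := eq_true trivial
  map_sSup' A := by
    rw [sSup_Prop_eq]
    exact propext (Opens.mem_sSup.trans ⟨fun ⟨U, hU, hp⟩ => ⟨_, ⟨U, hU, rfl⟩, hp⟩,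
      fun ⟨_, ⟨U, hU, rfl⟩, hp⟩ => ⟨U, hU, hp⟩⟩)

/-- A frame point restricts to a prime filter of clopen upsets, which is realised by some `p`;
agreement extends to all opens because each is a join of compact ones. -/
theorem evalPoint_surjective : Function.Surjective (evalPoint (P := P)) := by
  intro x
  obtain ⟨p, hp⟩ := exists_forall_mem_iff (P := P) (fun L => ∃ h : IsClopenUpset L, x h.opens)
    ⟨isClopenUpset_univ, of_eq_true (map_top x)⟩
    (fun ⟨_, h⟩ => (map_bot x).le (x.apply_mono (b := ⊥) (fun _ hp => hp) h))
    (fun L M _ _ ⟨hL, hxL⟩ ⟨hM, hxM⟩ => ⟨hL.inter hM,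
      (iff_of_eq (map_inf x hL.opens hM.opens)).2 ⟨hxL, hxM⟩⟩)
    (fun L M hL hM ⟨_, h⟩ =>
      ((iff_of_eq (map_sup x hL.opens hM.opens)).1 h).imp (fun h => ⟨hL, h⟩) (fun h => ⟨hM, h⟩))
    (fun L M _ hM hLM ⟨_, h⟩ => ⟨hM, x.apply_mono hLM h⟩)
  refine ⟨p, DFunLike.ext _ _ fun U => propext ⟨fun hpU => ?_, fun hxU => ?_⟩⟩
  · obtain ⟨L, hL, hpL, hLU⟩ := exists_isClopenUpset_of_mem hpU
    obtain ⟨_, hx⟩ := (hp L hL).1 hpL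
    exact x.apply_mono hLU hx
  · rw [opens_eq_sSup U, map_sSup, sSup_Prop_eq] at hxU
    obtain ⟨_, ⟨V, ⟨hV, hVU⟩, rfl⟩, hxV⟩ := hxU
    have hV' := isCompactElement_opens_iff.1 hV
    exact hVU ((hp V hV').2 ⟨hV', hxV⟩)

/-- A zero-dimensional ultraposet is order isomorphic to the points of its frame of opens. -/
noncomputable def IsZeroDimensional.pointOrderIso (hP : IsZeroDimensional P) :
    P ≃o FramePoint (Opens P) :=
  RelIso.ofSurjective
    (OrderEmbedding.ofMapLEIff evalPoint fun _ _ =>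
      ⟨fun h => hP.le_iff.2 fun _ hL => h hL.opens, fun h _ hp =>
        let ⟨L, hL, hpL, hLU⟩ := exists_isClopenUpset_of_mem hp
        hLU (hP.le_iff.1 h L hL hpL)⟩)
    evalPoint_surjective

theorem IsZeroDimensional.pointOrderIso_pair (hP : IsZeroDimensional P) (S : Type u) (f : S → P)
    (μ : Ultrafilter S) :
    hP.pointOrderIso (pair f μ) = pair (fun s => hP.pointOrderIso (f s)) μ :=
  DFunLike.ext _ _ fun U => propext
    ⟨fun hp =>
      let ⟨_, hL, hpL, hLU⟩ := exists_isClopenUpset_of_mem (U := U) hp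
      ⟨hL.opens, isCompactElement_opens_iff.2 hL, hLU, (hL.pair_mem_iff f μ).1 hpL⟩,
    fun ⟨_, hV, hVU, hm⟩ => hVU (((isCompactElement_opens_iff.1 hV).pair_mem_iff f μ).2 hm)⟩

end Opens

/-! ### Zero-dimensionality of models and points -/

theorem isZeroDimensional_latticeModel (D : Type u) [DistribLattice D] [BoundedOrder D] :
    IsZeroDimensional (LatticeModel D) := by
  intro p q hpq
  obtain ⟨d, hp, hq⟩ : ∃ d, p d ∧ ¬ q d := by
    by_contra! h
    exact hpq h
  exact ⟨_, {x | x d}, isClopenUpset_iff.2 ⟨fun _ _ h hx => h d hx, fun _ _ _ => Iff.rfl⟩, hp, hq⟩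

theorem isZeroDimensional_framePoint (L : Type u) [Order.Frame L] [IsCoherentFrame L] :
    IsZeroDimensional (FramePoint L) := by
  intro p q hpq
  obtain ⟨a, hp, hq⟩ : ∃ a, p a ∧ ¬ q a := by
    by_contra! h
    exact hpq h
  -- The separating `a` is replaced by a compact `k ≤ a`, since ultraproducts of points are computed
  -- pointwise only at compact elements.
  rw [IsCoherentFrame.eq_sSup_compact a, map_sSup, sSup_Prop_eq] at hp
  obtain ⟨_, ⟨k, ⟨hk, hka⟩, rfl⟩, hpk⟩ := hp
  exact ⟨_, {x | x k}, isClopenUpset_iff.2 ⟨fun _ _ h hx => h k hx,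
    fun _ f μ => FramePoint.ultraproduct_apply_of_isCompactElement f μ hk⟩, hpk,
    fun h => hq (q.apply_mono hka h)⟩

end Ultraposet

open Ultraposet

/-! ### Isomorphisms of ultraposets -/

theorem OrderIso.symm_ultraposet_pair {P Q : Type u} [Ultraposet P] [Ultraposet Q] (e : P ≃o Q)
    (he : ∀ (S : Type u) (f : S → P) (μ : Ultrafilter S), e (pair f μ) = pair (fun s => e (f s)) μ)
    {S : Type u} (f : S → Q) (μ : Ultrafilter S) :
    e.symm (pair f μ) = pair (fun s => e.symm (f s)) μ := by
  rw [e.symm_apply_eq, he]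
  simp only [e.apply_symm_apply]

/-- An order isomorphism that preserves ultraproducts is an isomorphism of ultraposets. -/
def UltPos.isoOfOrderIso {P Q : UltPos.{u}} (e : P.carrier ≃o Q.carrier)
    (he : ∀ (S : Type u) (f : S → P.carrier) (μ : Ultrafilter S),
      e (pair f μ) = pair (fun s => e (f s)) μ) : P ≅ Q where
  hom := (⟨e, e.monotone, he _⟩ : Ultrafunctor P.carrier Q.carrier)
  inv := (⟨e.symm, e.symm.monotone, e.symm_ultraposet_pair he⟩ :
    Ultrafunctor Q.carrier P.carrier)
  hom_inv_id := Ultrafunctor.ext (funext e.symm_apply_apply)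
  inv_hom_id := Ultrafunctor.ext (funext e.apply_symm_apply)

/-- The order isomorphism underlying an isomorphism of ultraposets. -/
def UltPos.orderIsoOfIso {P Q : UltPos.{u}} (i : P ≅ Q) : P.carrier ≃o Q.carrier :=
  Equiv.toOrderIso
    { toFun := Ultrafunctor.toFun i.hom
      invFun := Ultrafunctor.toFun i.inv
      left_inv := congrFun (congrArg Ultrafunctor.toFun i.hom_inv_id)
      right_inv := congrFun (congrArg Ultrafunctor.toFun i.inv_hom_id) }
    (Ultrafunctor.monotone i.hom) (Ultrafunctor.monotone i.inv)

/-- An order isomorphism that preserves ultraproducts is an isomorphism for left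
ultrafunctors. -/
def UltLPos.isoOfOrderIso {P Q : UltLPos.{u}} (e : P.carrier ≃o Q.carrier)
    (he : ∀ (S : Type u) (f : S → P.carrier) (μ : Ultrafilter S),
      e (pair f μ) = pair (fun s => e (f s)) μ) : P ≅ Q where
  hom := (⟨e, e.monotone, fun f μ => (he _ f μ).le⟩ : LeftUltrafunctor P.carrier Q.carrier)
  inv := (⟨e.symm, e.symm.monotone, fun f μ => (e.symm_ultraposet_pair he f μ).le⟩ :
    LeftUltrafunctor Q.carrier P.carrier)
  hom_inv_id := LeftUltrafunctor.ext (funext e.symm_apply_apply)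
  inv_hom_id := LeftUltrafunctor.ext (funext e.apply_symm_apply)

/-- The order isomorphism underlying an isomorphism for left ultrafunctors. -/
def UltLPos.orderIsoOfIso {P Q : UltLPos.{u}} (i : P ≅ Q) : P.carrier ≃o Q.carrier :=
  Equiv.toOrderIso
    { toFun := LeftUltrafunctor.toFun i.hom
      invFun := LeftUltrafunctor.toFun i.inv
      left_inv := congrFun (congrArg LeftUltrafunctor.toFun i.hom_inv_id)
      right_inv := congrFun (congrArg LeftUltrafunctor.toFun i.inv_hom_id) }
    (LeftUltrafunctor.monotone i.hom) (LeftUltrafunctor.monotone i.inv)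

/-- Isomorphisms for left ultrafunctors preserve ultraproducts. -/
theorem UltLPos.orderIsoOfIso_pair {P Q : UltLPos.{u}} (i : P ≅ Q) (S : Type u)
    (f : S → P.carrier) (μ : Ultrafilter S) :
    orderIsoOfIso i (pair f μ) = pair (fun s => orderIsoOfIso i (f s)) μ := by
  refine le_antisymm (LeftUltrafunctor.map_pair_le i.hom f μ) ?_
  -- The reverse inequality is the lax inequality for the inverse, moved across the order
  -- isomorphism.
  rw [← (orderIsoOfIso i).symm_apply_le]
  refine (LeftUltrafunctor.map_pair_le i.inv (fun s => orderIsoOfIso i (f s)) μ).trans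
    (pair_mono μ _ _ fun s => ?_)
  exact ((orderIsoOfIso i).symm_apply_apply (f s)).le

/-! ### Identification of the essential images -/

theorem cUltPos_iff {P : UltPos.{u}} : CUltPos P ↔ IsZeroDimensional P.carrier := by
  constructor
  · rintro ⟨D, ⟨i⟩⟩
    exact (isZeroDimensional_latticeModel D.unop).of_orderEmbedding
      (UltPos.orderIsoOfIso i.symm).toOrderEmbedding (fun _ => Ultrafunctor.map_pair i.inv)
  · intro hP
    exact ⟨Opposite.op (BddDistLat.of (clopenUpsets P.carrier)),
      ⟨(UltPos.isoOfOrderIso hP.modelOrderIso hP.modelOrderIso_pair).symm⟩⟩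

theorem cUltLPos_iff {P : UltLPos.{u}} : CUltLPos P ↔ IsZeroDimensional P.carrier := by
  constructor
  · rintro ⟨L, ⟨i⟩⟩
    have : IsCoherentFrame L.obj := L.property
    exact (isZeroDimensional_framePoint L.obj).of_orderEmbedding
      (UltLPos.orderIsoOfIso i.symm).toOrderEmbedding (UltLPos.orderIsoOfIso_pair i.symm)
  · intro hP
    let _ := clopenUpsetTopology P.carrier
    exact ⟨⟨Locale.of (TopologicalSpace.Opens P.carrier),
        inferInstanceAs (IsCoherentFrame (TopologicalSpace.Opens P.carrier))⟩,
      ⟨(UltLPos.isoOfOrderIso hP.pointOrderIso hP.pointOrderIso_pair).symm⟩⟩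

theorem mainTheorem3 :
    CUltPos.{u} = (fun P : UltPos.{u} => Ultraposet.IsZeroDimensional P.carrier) ∧
      CUltLPos.{u} = (fun P : UltLPos.{u} => Ultraposet.IsZeroDimensional P.carrier) := 
  ⟨funext fun _ => propext cUltPos_iff, funext fun _ => propext cUltLPos_iff⟩
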